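/- Let $S=\{s_1,\dots,s_n\}$, $n\ge 2$, be an arbitrary collection of $n$ nondegenerate closed line segments in the plane; crossings, shared endpoints, several segments through one point, and overlaps are allowed. If several segments lie on a common non-vertical line, then the larger one in a fixed total order on the segments is regarded as infinitesimally higher. The trapezoidation of a set of segments is the subdivision of the plane by the segments together with the vertical rays shot up and down from every endpoint and every intersection point of segments with different supporting lines until the rays meet the next segment; overlapping segments enclose trapezoids of zero area, which are cut where a segment with a different supporting line meets them. The Trapezoidal Search DAG (TSD) of $S$ for an insertion order has as nodes all faces of the trapezoidations that occur while the segments are inserted one by one; its root is the whole plane, and when the insertion of a segment destroys faces $L_1,\dots,L_a$ and creates faces $N_1,\dots,N_b$, then $N_i$ becomes a child of $L_j$ whenever their regions intersect. Each node stores its closed region. There is an absolute constant $C$ such that the following holds for all such $n$, $S$ and every fixed vertical query segment $q=\{c\}\times[y_0,y_1]$, $y_0\le y_1$. Build the TSD by inserting the segments of $S$ in a uniformly random order. The depth-first search that starts at the root and visits only nodes whose stored region meets $q$ (where each examination of a node on the stack, i.e. of the root or of the end of an edge that leaves a visited node, costs one step) always terminates, and its expected number of steps is at most $C\,(k+\log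 n)$, where $k$ is the number of segments of $S$ that intersect $q$. -/

import Mathlib

/-- A nondegenerate line segment in the plane, given by its lexicographically smaller endpoint
`left` and its lexicographically larger endpoint `right`. -/
structure PlaneSegment where
  left : ℝ × ℝ
  right : ℝ × ℝ
  left_lt_right : left.1 < right.1 ∨ (left.1 = right.1 ∧ left.2 < right.2)

namespace PlaneSegment

/-- The set of points of the segment (endpoints included). -/
def carrier (s : PlaneSegment) : Set (ℝ × ℝ) := segment ℝ s.left s.right

/-- The height at abscissa `x` of the supporting line of a segment that is not vertical. -/
noncomputable def height (s : PlaneSegment) (x : ℝ) : ℝ :=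
  s.left.2 + (s.right.2 - s.left.2) / (s.right.1 - s.left.1) * (x - s.left.1)

/-- Two segments have the same supporting line, i.e. they belong to the same bundle. -/
def SameLine (s t : PlaneSegment) : Prop :=
  Collinear ℝ {s.left, s.right, t.left, t.right}

/-- The segment is not vertical and lies over the whole open interval `(l, r)`. -/
def Spans (s : PlaneSegment) (l r : EReal) : Prop :=
  s.left.1 < s.right.1 ∧ (s.left.1 : EReal) ≤ l ∧ r ≤ (s.right.1 : EReal)

end PlaneSegment

/-- The vertical query segment with lower endpoint `(c, y₀)` and upper endpoint `(c, y₁)`. -/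
def verticalSegment (c y₀ y₁ : ℝ) : Set (ℝ × ℝ) := {p | p.1 = c ∧ y₀ ≤ p.2 ∧ p.2 ≤ y₁}

/-- The description of a trapezoid: the segments that bound it from below and from above
(`none` if it is unbounded in that direction) and the abscissae of its left and right walls
(`⊥` and `⊤` if there is no such wall). -/
@[ext] structure Trapezoid (n : ℕ) where
  bottom : Option (Fin n)
  top : Option (Fin n)
  left : EReal
  right : EReal

/-- The whole plane. -/
noncomputable def Trapezoid.plane (n : ℕ) : Trapezoid n := ⟨none, none, ⊥, ⊤⟩

section Trapezoidation

variable {n : ℕ} (S : Fin n → PlaneSegment)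

/-- Height of a lower boundary at `x` (`-∞` if there is none). -/
noncomputable def lowerHeight (b : Option (Fin n)) (x : ℝ) : EReal :=
  b.elim ⊥ fun i => ((S i).height x : EReal)

/-- Height of an upper boundary at `x` (`+∞` if there is none). -/
noncomputable def upperHeight (t : Option (Fin n)) (x : ℝ) : EReal :=
  t.elim ⊤ fun i => ((S i).height x : EReal)

/-- The lower boundary `b` runs below the upper boundary `t` at `x`. Two segments of one bundle
are compared by the fixed total order on the segments (the order of the indices): the larger one
is considered to be infinitesimally higher. -/
def RunsBelow (b t : Option (Fin n)) (x : ℝ) : Prop :=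
  lowerHeight S b x < upperHeight S t x ∨
    ∃ i j, b = some i ∧ t = some j ∧ (S i).SameLine (S j) ∧ i < j

/-- At abscissa `x`, the segment `j` interferes with the face between `b` and `t`: it has a point
on the closed vertical interval between them. The exceptions are segments of the bundle of
`b` that are not above `b` in the tie-breaking order (such as `b` itself), and segments of the
bundle of `t` that are not below `t`. In particular, a point where a segment meets `b` or `t`
from another supporting line always emits a vertical wall to both sides, and it pinches the
bundle, whereas overlaps within a bundle do not create intersection points. -/
def Interferes (b t : Option (Fin n)) (x : ℝ) (j : Fin n) : Prop :=
  (∃ y : ℝ, (x, y) ∈ (S j).carrier ∧ lowerHeight S b x ≤ y ∧ (y : EReal) ≤ upperHeight S t x) ∧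
    (¬ ∃ i, b = some i ∧ (S i).SameLine (S j) ∧ j ≤ i) ∧
    (¬ ∃ i, t = some i ∧ (S i).SameLine (S j) ∧ i ≤ j)

/-- A candidate region for the segments with index in `R`: over the open `x`-interval of `D` its
bottom runs below its top, and no segment and no wall runs through it. -/
def IsFreeRegion (R : Finset (Fin n)) (D : Trapezoid n) : Prop :=
  D.left < D.right ∧
  (∀ i, D.bottom = some i → i ∈ R ∧ (S i).Spans D.left D.right) ∧
  (∀ i, D.top = some i → i ∈ R ∧ (S i).Spans D.left D.right) ∧
  ∀ x : ℝ, D.left < (x : EReal) → (x : EReal) < D.right →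
    RunsBelow S D.bottom D.top x ∧ ∀ j ∈ R, ¬ Interferes S D.bottom D.top x j

/-- The faces of the trapezoidation of the segments with index in `R`: the free regions that
cannot be prolonged to the left or to the right. -/
def trapezoidation (R : Finset (Fin n)) : Set (Trapezoid n) :=
  {D | IsFreeRegion S R D ∧ ∀ D', IsFreeRegion S R D' → D'.bottom = D.bottom → D'.top = D.top →
    D'.left ≤ D.left → D.right ≤ D'.right → D' = D}

/-- The closed region of the plane that is stored with a trapezoid. -/
def Trapezoid.region (D : Trapezoid n) : Set (ℝ × ℝ) :=
  {p | D.left ≤ (p.1 : EReal) ∧ (p.1 : EReal) ≤ D.right ∧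
    lowerHeight S D.bottom p.1 ≤ (p.2 : EReal) ∧ (p.2 : EReal) ≤ upperHeight S D.top p.1}

/-- The interiors of two trapezoids intersect, where trapezoids of zero area between
overlapping segments are treated as if they had positive height. -/
def Trapezoid.Overlaps (D E : Trapezoid n) : Prop :=
  ∃ x : ℝ, (D.left < (x : EReal) ∧ (x : EReal) < D.right) ∧
    (E.left < (x : EReal) ∧ (x : EReal) < E.right) ∧
    RunsBelow S D.bottom E.top x ∧ RunsBelow S E.bottom D.top x

/-- The segments present after `m` insertions, when the `i`-th inserted segment is `σ i`. -/
def insertedFirst (σ : Equiv.Perm (Fin n)) (m : ℕ) : Finset (Fin n) :=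
  Finset.univ.filter fun j => (σ.symm j : ℕ) < m

/-- The edges of the Trapezoidal Search DAG for the insertion order `σ`. Its nodes are the faces
of all the trapezoidations that occur during the insertion, its root is the whole plane. The
insertion number `m + 1` destroys the leaves `D` that are no longer faces, creates one node for
every new face `E`, and makes `E` a child of `D` if their regions intersect. -/
def TSDChild (σ : Equiv.Perm (Fin n)) (D E : Trapezoid n) : Prop :=
  ∃ m < n,
    (D ∈ trapezoidation S (insertedFirst σ m) ∧ D ∉ trapezoidation S (insertedFirst σ (m + 1))) ∧
    (E ∉ trapezoidation S (insertedFirst σ m) ∧ E ∈ trapezoidation S (insertedFirst σ (m + 1))) ∧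
    D.Overlaps S E

end Trapezoidation

/-- `DFSRun child test stack marked out t`: depth-first search on a DAG with edge relation
`child`, started with the given stack of nodes to be examined and the given set of already visited
nodes, halts after `t` steps and reports the leaves in `out`. In one step the search takes a node
from the stack. It drops the node if the node has been visited before or fails `test`.
Otherwise it visits the node: it marks it, reports it if it has no children, and else puts its
children on the stack, each of them once, in any order. Thus a node visit and the examination of an
edge that leaves a visited node cost constant time each. -/
inductive DFSRun {V : Type*} (child : V → V → Prop) (test : V → Prop) :
    List V → Set V → List V → ℕ → Prop
  | halt (marked : Set V) : DFSRun child test [] marked [] 0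
  | drop {v : V} {stack : List V} {marked : Set V} {out : List V} {t : ℕ} :
      (v ∈ marked ∨ ¬ test v) → DFSRun child test stack marked out t →
      DFSRun child test (v :: stack) marked out (t + 1)
  | report {v : V} {stack : List V} {marked : Set V} {out : List V} {t : ℕ} :
      v ∉ marked → test v → (∀ w, ¬ child v w) →
      DFSRun child test stack (insert v marked) out t →
      DFSRun child test (v :: stack) marked (v :: out) (t + 1)
  | descend {v : V} {stack : List V} {marked : Set V} {out : List V} {t : ℕ} (children : List V) :
      v ∉ marked → test v → children ≠ [] → children.Nodup → (∀ w, w ∈ children ↔ child v w) →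
      DFSRun child test (children ++ stack) (insert v marked) out t →
      DFSRun child test (v :: stack) marked out (t + 1)

/-- With query set `q`, the search in the Trapezoidal Search DAG for the insertion order `σ`,
which starts at the root and visits only nodes whose stored region meets `q`, halts after
`t` steps. -/
def TSDQueryHaltsIn {n : ℕ} (S : Fin n → PlaneSegment) (σ : Equiv.Perm (Fin n))
    (q : Set (ℝ × ℝ)) (t : ℕ) : Prop :=
  ∃ out : List (Trapezoid n),
    DFSRun (TSDChild S σ) (fun D => (D.region S ∩ q).Nonempty) [Trapezoid.plane n] ∅ out t

/-! The cost of a search is governed by the number of DAG nodes whose region meets `q`. A destroyed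
face overlaps at most four new faces (below the new segment, above it, and one on either side of it:
`new_faces_card_le`) and is destroyed only once. So every node has at most four children, and since
no node is visited twice, the search takes at most one step plus four per node that meets `q`
(`TSDQueryHaltsIn.le`).

That number is bounded by backward analysis. Let `R` be the first m + 1 segments, of which k_R meet
`q`. Going up along either side of the line x = c, every face meeting `q` except the lowest starts
at a segment that meets `q`; hence at most 2(k_R + 1) faces meet `q` (`queryFaces_card_le`). A face
is lost only by removing its bottom, its top, or at most one segment responsible for each wall
(`removals_card_le`). The last segment inserted is uniform in `R` (`sum_last_inserted`), so the
insertion creates on average at most 8(E[k_R] + 1)/(m + 1) nodes meeting `q`. Here E[k_R]/(m + 1) is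
the probability that the last segment meets `q`, which sums to k over all m; the rest sums to eight
times a harmonic number.

Degenerate positions enter only through `RunsBelow` and `Interferes`. Both persist between two
abscissae, and `RunsBelow` is asymmetric; these facts replace general position. -/

namespace PlaneSegment

/-! ### Segments as graphs of affine functions -/

theorem height_affine (s : PlaneSegment) (x₁ x₂ u v : ℝ) (h : u + v = 1) :
    s.height (u * x₁ + v * x₂) = u * s.height x₁ + v * s.height x₂ := by
  obtain rfl : u = 1 - v := by linarith
  unfold height; ring

theorem height_left (s : PlaneSegment) : s.height s.left.1 = s.left.2 := by
  unfold height; ring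

theorem height_right (s : PlaneSegment) (h : s.left.1 < s.right.1) :
    s.height s.right.1 = s.right.2 := by
  unfold height
  have : s.right.1 - s.left.1 ≠ 0 := by linarith
  field_simp; ring

theorem mem_carrier_iff (s : PlaneSegment) (h : s.left.1 < s.right.1) (x y : ℝ) :
    (x, y) ∈ s.carrier ↔ s.left.1 ≤ x ∧ x ≤ s.right.1 ∧ y = s.height x := by
  constructor
  · rintro ⟨u, v, hu, hv, huv, hp⟩
    have h1 := congrArg Prod.fst hp
    have h2 := congrArg Prod.snd hp
    simp only [Prod.fst_add, Prod.smul_fst, smul_eq_mul, Prod.snd_add, Prod.smul_snd] at h1 h2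
    refine ⟨?_, ?_, ?_⟩
    · rw [← h1]; nlinarith [mul_nonneg hv (sub_pos.2 h).le, congrArg (· * s.left.1) huv]
    · rw [← h1]; nlinarith [mul_nonneg hu (sub_pos.2 h).le, congrArg (· * s.right.1) huv]
    · rw [← h1, ← h2, s.height_affine _ _ _ _ huv, s.height_left, s.height_right h]
  · rintro ⟨h1, h2, rfl⟩
    have hd : 0 < s.right.1 - s.left.1 := by linarith
    refine ⟨(s.right.1 - x) / (s.right.1 - s.left.1), (x - s.left.1) / (s.right.1 - s.left.1),
      div_nonneg (by linarith) hd.le, div_nonneg (by linarith) hd.le, by field_simp; ring, ?_⟩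
    ext
    · simp only [Prod.fst_add, Prod.smul_fst, smul_eq_mul]
      field_simp; ring
    · simp only [Prod.snd_add, Prod.smul_snd, smul_eq_mul, height]
      field_simp; ring

/-- The common line is the graph of `s.height`. A vertical `t` on it would have two endpoints of
equal height, against the lexicographic order, so bundles reduce to equality of height functions. -/
theorem sameLine_iff (s t : PlaneSegment) (hs : s.left.1 < s.right.1) :
    s.SameLine t ↔ t.left.1 < t.right.1 ∧ ∀ x, s.height x = t.height x := by
  have hd : s.right.1 - s.left.1 ≠ 0 := by linarith
  constructor
  · intro h
    have hsub : ∀ p ∈ ({s.left, s.right, t.left, t.right} : Set (ℝ × ℝ)), p.2 = s.height p.1 := by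
      obtain ⟨v, hv⟩ := (collinear_iff_of_mem (p₀ := s.left) (by simp)).1 h
      obtain ⟨r₀, h₀⟩ := hv s.right (by simp)
      intro p hp
      obtain ⟨r, rfl⟩ := hv p hp
      have h₁ := congrArg Prod.fst h₀
      have h₂ := congrArg Prod.snd h₀
      simp only [vadd_eq_add, Prod.fst_add, Prod.snd_add, Prod.smul_fst, Prod.smul_snd,
        smul_eq_mul] at h₁ h₂
      simp only [vadd_eq_add, Prod.fst_add, Prod.snd_add, Prod.smul_fst, Prod.smul_snd,
        smul_eq_mul, height]
      field_simp
      rw [h₁, h₂]; ring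
    have hl := hsub t.left (by simp)
    have hr := hsub t.right (by simp)
    have ht : t.left.1 < t.right.1 := by
      rcases t.left_lt_right with h | ⟨h1, h2⟩
      · exact h
      · rw [hl, hr, h1] at h2; exact absurd h2 (lt_irrefl _)
    refine ⟨ht, fun x => ?_⟩
    have hd' : t.right.1 - t.left.1 ≠ 0 := by linarith
    conv_rhs => unfold height
    rw [hl, hr]
    unfold height
    field_simp; ring
  · rintro ⟨ht, h⟩
    unfold SameLine
    rw [collinear_iff_of_mem (p₀ := s.left) (by simp)]
    refine ⟨(1, (s.right.2 - s.left.2) / (s.right.1 - s.left.1)), ?_⟩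
    have key : ∀ p : ℝ × ℝ, p.2 = s.height p.1 → ∃ r : ℝ,
        p = r • ((1 : ℝ), (s.right.2 - s.left.2) / (s.right.1 - s.left.1)) +ᵥ s.left := by
      intro p hp
      refine ⟨p.1 - s.left.1, ?_⟩
      ext
      · simp
      · simp only [vadd_eq_add, Prod.snd_add, Prod.smul_snd, smul_eq_mul, hp, height]; ring
    rintro p (rfl | rfl | rfl | rfl)
    · exact key _ s.height_left.symm
    · exact key _ (s.height_right hs).symm
    · exact key _ (by rw [h, t.height_left])
    · exact key _ (by rw [h, t.height_right ht])

theorem sameLine_comm {s t : PlaneSegment} : s.SameLine t ↔ t.SameLine s := by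
  unfold SameLine
  have : ({s.left, s.right, t.left, t.right} : Set (ℝ × ℝ)) =
      {t.left, t.right, s.left, s.right} := by
    ext; simp only [Set.mem_insert_iff, Set.mem_singleton_iff]; tauto
  rw [this]

theorem sameLine_refl (s : PlaneSegment) : s.SameLine s := by
  unfold SameLine
  have : ({s.left, s.right, s.left, s.right} : Set (ℝ × ℝ)) = {s.left, s.right} := by
    ext; simp only [Set.mem_insert_iff, Set.mem_singleton_iff]; tauto
  rw [this]
  exact collinear_pair ℝ _ _

/-- The segment is not vertical and its projection contains `x`. -/
def Over (s : PlaneSegment) (x : ℝ) : Prop :=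
  s.left.1 < s.right.1 ∧ s.left.1 ≤ x ∧ x ≤ s.right.1

theorem Over.mem {s : PlaneSegment} {x : ℝ} (h : s.Over x) : (x, s.height x) ∈ s.carrier :=
  (s.mem_carrier_iff h.1 _ _).2 ⟨h.2.1, h.2.2, rfl⟩

theorem Over.between {s : PlaneSegment} {x₁ x₂ x : ℝ} (h₁ : s.Over x₁) (h₂ : s.Over x₂)
    (h : x₁ ≤ x) (h' : x ≤ x₂) : s.Over x :=
  ⟨h₁.1, h₁.2.1.trans h, h'.trans h₂.2.2⟩

theorem Spans.over {s : PlaneSegment} {l r : EReal} (h : s.Spans l r) {x : ℝ} (hl : l ≤ x)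
    (hr : x ≤ r) : s.Over x :=
  ⟨h.1, EReal.coe_le_coe_iff.1 (h.2.1.trans hl), EReal.coe_le_coe_iff.1 (hr.trans h.2.2)⟩

end PlaneSegment

/-! ### Free regions and the uniqueness of faces -/

section Faces

variable {n : ℕ} (S : Fin n → PlaneSegment)

theorem exists_affine_weights {x₁ x₂ x : ℝ} (h₁ : x₁ ≤ x) (h₂ : x ≤ x₂) :
    ∃ u v : ℝ, 0 ≤ u ∧ 0 ≤ v ∧ u + v = 1 ∧ x = u * x₁ + v * x₂ := by
  have : x ∈ segment ℝ x₁ x₂ := by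
    rw [segment_eq_Icc (h₁.trans h₂)]; exact ⟨h₁, h₂⟩
  obtain ⟨u, v, hu, hv, h, rfl⟩ := this
  exact ⟨u, v, hu, hv, h, rfl⟩

/-- A strict inequality between affine functions at both ends persists in between, and the
tie-breaking alternative does not depend on the abscissa. -/
theorem RunsBelow.between {b t : Option (Fin n)} {x₁ x₂ x : ℝ} (h₁ : RunsBelow S b t x₁)
    (h₂ : RunsBelow S b t x₂) (hx₁ : x₁ ≤ x) (hx₂ : x ≤ x₂) : RunsBelow S b t x := by
  rcases h₁ with h₁ | h₁
  · rcases h₂ with h₂ | h₂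
    · left
      rcases b with _ | b <;> rcases t with _ | t
      · simp [lowerHeight, upperHeight]
      · simp [lowerHeight, upperHeight]
      · simp [lowerHeight, upperHeight]
      · simp only [lowerHeight, upperHeight, Option.elim, EReal.coe_lt_coe_iff] at *
        obtain ⟨u, v, hu, hv, huv, rfl⟩ := exists_affine_weights hx₁ hx₂
        rw [PlaneSegment.height_affine _ _ _ _ _ huv, PlaneSegment.height_affine _ _ _ _ _ huv]
        rcases hu.eq_or_lt with rfl | hu
        · obtain rfl : v = 1 := by linarith
          linarith
        · nlinarith
    · exact Or.inr h₂
  · exact Or.inr h₁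

theorem RunsBelow.le {b t : Option (Fin n)} {x : ℝ} (h : RunsBelow S b t x)
    (hb : ∀ i, b = some i → (S i).Over x) : lowerHeight S b x ≤ upperHeight S t x := by
  rcases h with h | ⟨i, j, rfl, rfl, h, -⟩
  · exact h.le
  · have := ((PlaneSegment.sameLine_iff _ _ (hb i rfl).1).1 h).2 x
    simp [lowerHeight, upperHeight, this]

/-- Segments of one bundle have equal heights, so a strict height comparison and a tie-break can
never disagree. With `j = i` this also gives irreflexivity. -/
theorem RunsBelow.asymm {i j : Fin n} {x : ℝ} (hi : (S i).Over x)
    (h : RunsBelow S (some i) (some j) x) (h' : RunsBelow S (some j) (some i) x) : False := by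
  have key : ∀ h : (S i).SameLine (S j), (S i).height x = (S j).height x := fun h =>
    ((PlaneSegment.sameLine_iff _ _ hi.1).1 h).2 x
  rcases h with h | ⟨i', j', hi', hj', h, hlt⟩
  · simp only [lowerHeight, upperHeight, Option.elim, EReal.coe_lt_coe_iff] at h
    rcases h' with h' | ⟨i', j', hi', hj', h', hlt⟩
    · simp only [lowerHeight, upperHeight, Option.elim, EReal.coe_lt_coe_iff] at h'
      linarith
    · cases hi'; cases hj'
      have := key (PlaneSegment.sameLine_comm.1 h')
      linarith
  · cases hi'; cases hj'
    have := key h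
    rcases h' with h' | ⟨i', j', hi', hj', h', hlt'⟩
    · simp only [lowerHeight, upperHeight, Option.elim, EReal.coe_lt_coe_iff] at h'
      linarith
    · cases hi'; cases hj'
      exact lt_asymm hlt hlt'

/-- The vertical line at `x` between the boundaries `b` and `t` is not touched by any segment
with index in `R`. -/
def FreeAt (R : Finset (Fin n)) (b t : Option (Fin n)) (x : ℝ) : Prop :=
  RunsBelow S b t x ∧ ∀ j ∈ R, ¬ Interferes S b t x j

variable {S}

theorem FreeAt.mono {R R' : Finset (Fin n)} (hR : R ⊆ R') {b t : Option (Fin n)} {x : ℝ}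
    (h : FreeAt S R' b t x) : FreeAt S R b t x :=
  ⟨h.1, fun j hj => h.2 j (hR hj)⟩

/-- A segment of `R` above `b` that does not pass over `t` would interfere. Asymmetry rules out the
exemption through the bundle of `b`, so only the one through the bundle of `t` is left, and it
yields the conclusion. -/
theorem FreeAt.top_runsBelow {R : Finset (Fin n)} {b t : Option (Fin n)} {x : ℝ}
    (h : FreeAt S R b t x) (hb : ∀ i, b = some i → (S i).Over x) {j : Fin n} (hj : j ∈ R)
    (hjx : (S j).Over x) (hbj : RunsBelow S b (some j) x) :
    ∃ i, t = some i ∧ (i = j ∨ RunsBelow S (some i) (some j) x) := by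
  by_cases hle : upperHeight S (some j) x ≤ upperHeight S t x
  · have h1 := h.2 j hj
    unfold Interferes at h1
    by_cases h2 : ∃ i, t = some i ∧ (S i).SameLine (S j) ∧ i ≤ j
    · obtain ⟨i, rfl, hs, hij⟩ := h2
      refine ⟨i, rfl, ?_⟩
      rcases hij.eq_or_lt with e | e
      · exact Or.inl e
      · exact Or.inr (Or.inr ⟨i, j, rfl, rfl, hs, e⟩)
    · exfalso
      refine h1 ⟨⟨(S j).height x, hjx.mem, hbj.le S hb, hle⟩, ?_, h2⟩
      rintro ⟨i, rfl, hs, hji⟩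
      rcases hji.eq_or_lt with rfl | e
      · exact RunsBelow.asymm S hjx hbj hbj
      · exact RunsBelow.asymm S hjx (Or.inr ⟨j, i, rfl, rfl, PlaneSegment.sameLine_comm.1 hs, e⟩) hbj
  · rw [not_le] at hle
    rcases t with _ | i
    · simp [upperHeight] at hle
    · exact ⟨i, rfl, Or.inr (Or.inl hle)⟩

theorem FreeAt.runsBelow_bottom {R : Finset (Fin n)} {b t : Option (Fin n)} {x : ℝ}
    (h : FreeAt S R b t x) {j : Fin n} (hj : j ∈ R)
    (hjx : (S j).Over x) (hjt : RunsBelow S (some j) t x) :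
    ∃ i, b = some i ∧ (j = i ∨ RunsBelow S (some j) (some i) x) := by
  by_cases hle : lowerHeight S b x ≤ lowerHeight S (some j) x
  · have h1 := h.2 j hj
    unfold Interferes at h1
    by_cases h2 : ∃ i, b = some i ∧ (S i).SameLine (S j) ∧ j ≤ i
    · obtain ⟨i, rfl, hs, hij⟩ := h2
      refine ⟨i, rfl, ?_⟩
      rcases hij.eq_or_lt with e | e
      · exact Or.inl e
      · exact Or.inr (Or.inr ⟨j, i, rfl, rfl, PlaneSegment.sameLine_comm.1 hs, e⟩)
    · exfalso
      refine h1 ⟨⟨(S j).height x, hjx.mem, hle, hjt.le S fun i hi => by cases hi; exact hjx⟩, h2, ?_⟩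
      rintro ⟨i, rfl, hs, hji⟩
      rcases hji.eq_or_lt with rfl | e
      · exact RunsBelow.asymm S hjx hjt hjt
      · exact RunsBelow.asymm S hjx hjt (Or.inr ⟨i, j, rfl, rfl, hs, e⟩)
  · rw [not_le] at hle
    rcases b with _ | i
    · simp [lowerHeight] at hle
    · exact ⟨i, rfl, Or.inr (Or.inl hle)⟩

/-- The open abscissa interval of the trapezoid contains `x`. -/
def Trapezoid.OverAt (D : Trapezoid n) (x : ℝ) : Prop := D.left < (x : EReal) ∧ (x : EReal) < D.right

theorem IsFreeRegion.freeAt {R : Finset (Fin n)} {D : Trapezoid n} (h : IsFreeRegion S R D)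
    {x : ℝ} (hx : D.OverAt x) : FreeAt S R D.bottom D.top x := h.2.2.2 x hx.1 hx.2

theorem IsFreeRegion.bottom_over {R : Finset (Fin n)} {D : Trapezoid n} (h : IsFreeRegion S R D)
    {x : ℝ} (hx : D.OverAt x) (i : Fin n) (hi : D.bottom = some i) : (S i).Over x :=
  (h.2.1 i hi).2.over hx.1.le hx.2.le

theorem IsFreeRegion.top_over {R : Finset (Fin n)} {D : Trapezoid n} (h : IsFreeRegion S R D)
    {x : ℝ} (hx : D.OverAt x) (i : Fin n) (hi : D.top = some i) : (S i).Over x :=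
  (h.2.2.1 i hi).2.over hx.1.le hx.2.le

theorem IsFreeRegion.mono {R R' : Finset (Fin n)} (hR : R ⊆ R') {D : Trapezoid n}
    (h : IsFreeRegion S R' D) (hb : ∀ i, D.bottom = some i → i ∈ R)
    (ht : ∀ i, D.top = some i → i ∈ R) : IsFreeRegion S R D :=
  ⟨h.1, fun i hi => ⟨hb i hi, (h.2.1 i hi).2⟩, fun i hi => ⟨ht i hi, (h.2.2.1 i hi).2⟩,
    fun x h1 h2 => FreeAt.mono hR (h.2.2.2 x h1 h2)⟩

/-- Overlapping free regions have the same top if their tops belong to both sets of segments. -/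
theorem overlap_top_eq {R₁ R₂ : Finset (Fin n)} {D E : Trapezoid n} (hD : IsFreeRegion S R₁ D)
    (hE : IsFreeRegion S R₂ E) {x : ℝ} (hxD : D.OverAt x) (hxE : E.OverAt x)
    (h₁ : RunsBelow S D.bottom E.top x) (h₂ : RunsBelow S E.bottom D.top x)
    (hDt : ∀ i, D.top = some i → i ∈ R₂) (hEt : ∀ i, E.top = some i → i ∈ R₁) :
    E.top = D.top := by
  rcases hd : D.top with _ | i <;> rcases he : E.top with _ | j
  · rfl
  · obtain ⟨i, hi, -⟩ := (hD.freeAt hxD).top_runsBelow (hD.bottom_over hxD) (hEt j he)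
      (hE.top_over hxE j he) (he ▸ h₁)
    simp [hd] at hi
  · obtain ⟨i, hi, -⟩ := (hE.freeAt hxE).top_runsBelow (hE.bottom_over hxE) (hDt i hd)
      (hD.top_over hxD i hd) (hd ▸ h₂)
    simp [he] at hi
  · obtain ⟨i', hi', h3⟩ := (hD.freeAt hxD).top_runsBelow (hD.bottom_over hxD) (hEt j he)
      (hE.top_over hxE j he) (he ▸ h₁)
    obtain ⟨j', hj', h4⟩ := (hE.freeAt hxE).top_runsBelow (hE.bottom_over hxE) (hDt i hd)
      (hD.top_over hxD i hd) (hd ▸ h₂)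
    rw [hd] at hi'; cases hi'
    rw [he] at hj'; cases hj'
    rcases h3 with rfl | h3
    · rfl
    · rcases h4 with rfl | h4
      · rfl
      · exact (RunsBelow.asymm S (hD.top_over hxD i hd) h3 h4).elim

/-- Overlapping free regions have the same bottom if their bottoms belong to both sets. -/
theorem overlap_bottom_eq {R₁ R₂ : Finset (Fin n)} {D E : Trapezoid n} (hD : IsFreeRegion S R₁ D)
    (hE : IsFreeRegion S R₂ E) {x : ℝ} (hxD : D.OverAt x) (hxE : E.OverAt x)
    (h₁ : RunsBelow S D.bottom E.top x) (h₂ : RunsBelow S E.bottom D.top x)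
    (hDb : ∀ i, D.bottom = some i → i ∈ R₂) (hEb : ∀ i, E.bottom = some i → i ∈ R₁) :
    E.bottom = D.bottom := by
  rcases hd : D.bottom with _ | i <;> rcases he : E.bottom with _ | j
  · rfl
  · obtain ⟨i, hi, -⟩ := (hD.freeAt hxD).runsBelow_bottom (hEb j he)
      (hE.bottom_over hxE j he) (he ▸ h₂)
    simp [hd] at hi
  · obtain ⟨i, hi, -⟩ := (hE.freeAt hxE).runsBelow_bottom (hDb i hd)
      (hD.bottom_over hxD i hd) (hd ▸ h₁)
    simp [he] at hi
  · obtain ⟨i', hi', h3⟩ := (hD.freeAt hxD).runsBelow_bottom (hEb j he)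
      (hE.bottom_over hxE j he) (he ▸ h₂)
    obtain ⟨j', hj', h4⟩ := (hE.freeAt hxE).runsBelow_bottom (hDb i hd)
      (hD.bottom_over hxD i hd) (hd ▸ h₁)
    rw [hd] at hi'; cases hi'
    rw [he] at hj'; cases hj'
    rcases h3 with rfl | h3
    · rfl
    · rcases h4 with rfl | h4
      · rfl
      · exact (RunsBelow.asymm S (hD.bottom_over hxD i hd) h4 h3).elim

/-- Two faces with the same boundaries are equal if the strip between them is free. -/
theorem face_eq_of_free_between {R : Finset (Fin n)} {D E : Trapezoid n}
    (hD : D ∈ trapezoidation S R) (hE : E ∈ trapezoidation S R) (hb : E.bottom = D.bottom)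
    (ht : E.top = D.top) {x₁ x₂ : ℝ} (hx : x₁ ≤ x₂) (hxD : D.OverAt x₁) (hxE : E.OverAt x₂)
    (h : ∀ x, x₁ < x → x < x₂ → FreeAt S R D.bottom D.top x) : D = E := by
  have hx' : (x₁ : EReal) ≤ x₂ := EReal.coe_le_coe_iff.2 hx
  -- Both faces are contained in this hull, so maximality makes each equal to it. A point of the
  -- hull lies over `D`, over `E`, or strictly between `x₁` and `x₂`.
  have hF : IsFreeRegion S R ⟨D.bottom, D.top, min D.left E.left, max D.right E.right⟩ := by
    refine ⟨lt_of_le_of_lt (min_le_left _ _) (hD.1.1.trans_le (le_max_left _ _)), ?_, ?_, ?_⟩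
    · intro i hi
      have h1 := hD.1.2.1 i hi
      have h2 := hE.1.2.1 i (hb.trans hi)
      exact ⟨h1.1, h1.2.1, le_min h1.2.2.1 h2.2.2.1, max_le h1.2.2.2 h2.2.2.2⟩
    · intro i hi
      have h1 := hD.1.2.2.1 i hi
      have h2 := hE.1.2.2.1 i (ht.trans hi)
      exact ⟨h1.1, h1.2.1, le_min h1.2.2.1 h2.2.2.1, max_le h1.2.2.2 h2.2.2.2⟩
    · intro x h1 h2
      change FreeAt S R D.bottom D.top x
      by_cases hDx : D.OverAt x
      · exact hD.1.freeAt hDx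
      by_cases hEx : E.OverAt x
      · have := hE.1.freeAt hEx
        rwa [hb, ht] at this
      simp only [Trapezoid.OverAt, not_and, not_lt, min_lt_iff, lt_max_iff] at *
      refine h x (EReal.coe_lt_coe_iff.1 ?_) (EReal.coe_lt_coe_iff.1 ?_)
      · by_contra hc
        rw [not_lt] at hc
        rcases h1 with h1 | h1
        · exact absurd (hDx h1) (not_le.2 (hc.trans_lt hxD.2))
        · exact absurd (hEx h1) (not_le.2 ((hc.trans hx').trans_lt hxE.2))
      · by_contra hc
        rw [not_lt] at hc
        rcases h2 with h2 | h2
        · exact absurd (hDx (hxD.1.trans_le (hx'.trans hc))) (not_le.2 h2)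
        · exact absurd (hEx (hxE.1.trans_le hc)) (not_le.2 h2)
  have e1 := hD.2 _ hF rfl rfl (min_le_left _ _) (le_max_left _ _)
  have e2 := hE.2 _ hF hb.symm ht.symm (min_le_right _ _) (le_max_right _ _)
  exact e1.symm.trans e2

theorem face_eq_of_overlap {R : Finset (Fin n)} {D E : Trapezoid n}
    (hD : D ∈ trapezoidation S R) (hE : E ∈ trapezoidation S R) {x : ℝ} (hxD : D.OverAt x)
    (hxE : E.OverAt x) (h₁ : RunsBelow S D.bottom E.top x) (h₂ : RunsBelow S E.bottom D.top x) :
    D = E :=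
  face_eq_of_free_between hD hE
    (overlap_bottom_eq hD.1 hE.1 hxD hxE h₁ h₂ (fun i hi => (hD.1.2.1 i hi).1)
      fun i hi => (hE.1.2.1 i hi).1)
    (overlap_top_eq hD.1 hE.1 hxD hxE h₁ h₂ (fun i hi => (hD.1.2.2.1 i hi).1)
      fun i hi => (hE.1.2.2.1 i hi).1)
    le_rfl hxD hxE fun _ h h' => absurd (h.trans h') (lt_irrefl _)

/-- Two faces with the same bottom over a common abscissa are equal. -/
theorem face_eq_of_bottom_eq {R : Finset (Fin n)} {D E : Trapezoid n}
    (hD : D ∈ trapezoidation S R) (hE : E ∈ trapezoidation S R) {x : ℝ} (hxD : D.OverAt x)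
    (hxE : E.OverAt x) (h : D.bottom = E.bottom) : D = E :=
  face_eq_of_overlap hD hE hxD hxE (h ▸ (hE.1.freeAt hxE).1) (h ▸ (hD.1.freeAt hxD).1)

/-- A face that remains free remains a face. -/
theorem face_of_isFreeRegion {R R' : Finset (Fin n)} (hR : R ⊆ R') {D : Trapezoid n}
    (hD : D ∈ trapezoidation S R) (hD' : IsFreeRegion S R' D) : D ∈ trapezoidation S R' :=
  ⟨hD', fun D' h hb ht => hD.2 D' (h.mono hR (fun i hi => (hD.1.2.1 i (hb ▸ hi)).1)
    fun i hi => (hD.1.2.2.1 i (ht ▸ hi)).1) hb ht⟩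

/-- A destroyed face never occurs again. -/
theorem face_of_face_superset {R R' R'' : Finset (Fin n)} (h : R ⊆ R') (h' : R' ⊆ R'')
    {D : Trapezoid n} (hD : D ∈ trapezoidation S R) (hD' : D ∈ trapezoidation S R'') :
    D ∈ trapezoidation S R' :=
  face_of_isFreeRegion h hD (hD'.1.mono h' (fun i hi => h (hD.1.2.1 i hi).1)
    fun i hi => h (hD.1.2.2.1 i hi).1)

end Faces

/-! ### Insertion of one segment: at most four children -/

section Children

variable {n : ℕ} {S : Fin n → PlaneSegment}

theorem Trapezoid.OverAt.between {D : Trapezoid n} {x₁ x₂ x : ℝ} (h₁ : D.OverAt x₁)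
    (h₂ : D.OverAt x₂) (h : x₁ ≤ x) (h' : x ≤ x₂) : D.OverAt x :=
  ⟨h₁.1.trans_le (EReal.coe_le_coe_iff.2 h), (EReal.coe_le_coe_iff.2 h').trans_lt h₂.2⟩

/-- The segment is convex and the boundaries are affine, so convex combinations of the two points of
contact work; the bundle exemptions do not involve the abscissa. -/
theorem Interferes.between {b t : Option (Fin n)} {j : Fin n} {x₁ x₂ x : ℝ}
    (h₁ : Interferes S b t x₁ j) (h₂ : Interferes S b t x₂ j) (hx₁ : x₁ ≤ x) (hx₂ : x ≤ x₂) :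
    Interferes S b t x j := by
  obtain ⟨⟨p, hp, hbp, hpt⟩, hb, ht⟩ := h₁
  obtain ⟨⟨q, hq, hbq, hqt⟩, -, -⟩ := h₂
  obtain ⟨u, v, hu, hv, huv, rfl⟩ := exists_affine_weights hx₁ hx₂
  refine ⟨⟨u * p + v * q, ?_, ?_, ?_⟩, hb, ht⟩
  · exact convex_segment (𝕜 := ℝ) (S j).left (S j).right hp hq hu hv huv
  · rcases b with _ | b
    · simp [lowerHeight]
    · simp only [lowerHeight, Option.elim, EReal.coe_le_coe_iff] at *
      rw [PlaneSegment.height_affine _ _ _ _ _ huv]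
      nlinarith
  · rcases t with _ | t
    · simp [upperHeight]
    · simp only [upperHeight, Option.elim, EReal.coe_le_coe_iff] at *
      rw [PlaneSegment.height_affine _ _ _ _ _ huv]
      nlinarith

/-- Between two abscissae where the new segment `s` bounds a new face from above, the strip
between the old bottom and `s` is free. -/
theorem free_below_new {R : Finset (Fin n)} {s : Fin n} {D : Trapezoid n}
    (hD : IsFreeRegion S R D) {x₁ x₂ x : ℝ} (hx₁ : D.OverAt x₁) (hx₂ : D.OverAt x₂)
    (hs₁ : (S s).Over x₁) (hs₂ : (S s).Over x₂)
    (hb₁ : RunsBelow S D.bottom (some s) x₁) (hb₂ : RunsBelow S D.bottom (some s) x₂)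
    (ht₁ : RunsBelow S (some s) D.top x₁) (ht₂ : RunsBelow S (some s) D.top x₂)
    (h : x₁ ≤ x) (h' : x ≤ x₂) : FreeAt S (insert s R) D.bottom (some s) x := by
  have hx := hx₁.between hx₂ h h'
  have hs := hs₁.between hs₂ h h'
  have hb := hb₁.between S hb₂ h h'
  have ht := ht₁.between S ht₂ h h'
  refine ⟨hb, fun j hj => ?_⟩
  rintro ⟨⟨y, hy, hby, hys⟩, h1, h2⟩
  rcases Finset.mem_insert.1 hj with rfl | hj
  · exact h2 ⟨j, rfl, PlaneSegment.sameLine_refl _, le_rfl⟩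
  have hst := ht.le S (fun i hi => by cases hi; exact hs)
  refine (hD.freeAt hx).2 j hj ⟨⟨y, hy, hby, hys.trans hst⟩, h1, ?_⟩
  -- The only way out is that `j` was exempt in `D` as a member of the bundle of the old top. Being
  -- also at or below `s`, it then forces `s` into this bundle, and the index order makes `j` exempt
  -- with respect to `s` too.
  rintro ⟨i, hi, hij, hle⟩
  have hio := hD.top_over hx i hi
  obtain ⟨hj1, hj2⟩ := (PlaneSegment.sameLine_iff _ _ hio.1).1 hij
  have hyj := ((PlaneSegment.mem_carrier_iff _ hj1 _ _).1 hy).2.2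
  rw [hi] at hst ht
  simp only [lowerHeight, upperHeight, Option.elim, EReal.coe_le_coe_iff] at hst hys
  have e := hj2 x
  rcases ht with ht | ⟨s', i', hs', hi', hsi, hlt⟩
  · simp only [lowerHeight, upperHeight, Option.elim, EReal.coe_lt_coe_iff] at ht
    linarith
  · cases hs'; cases hi'
    refine h2 ⟨s, rfl, ?_, hlt.le.trans hle⟩
    rw [PlaneSegment.sameLine_iff _ _ hs.1]
    exact ⟨hj1, fun z => (((PlaneSegment.sameLine_iff _ _ hs.1).1 hsi).2 z).trans (hj2 z)⟩

/-- Mirror image of `free_below_new`, with the exemption passing from the old bottom to `s`. -/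
theorem free_above_new {R : Finset (Fin n)} {s : Fin n} {D : Trapezoid n}
    (hD : IsFreeRegion S R D) {x₁ x₂ x : ℝ} (hx₁ : D.OverAt x₁) (hx₂ : D.OverAt x₂)
    (hs₁ : (S s).Over x₁) (hs₂ : (S s).Over x₂)
    (hb₁ : RunsBelow S D.bottom (some s) x₁) (hb₂ : RunsBelow S D.bottom (some s) x₂)
    (ht₁ : RunsBelow S (some s) D.top x₁) (ht₂ : RunsBelow S (some s) D.top x₂)
    (h : x₁ ≤ x) (h' : x ≤ x₂) : FreeAt S (insert s R) (some s) D.top x := by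
  have hx := hx₁.between hx₂ h h'
  have hs := hs₁.between hs₂ h h'
  have hb := hb₁.between S hb₂ h h'
  have ht := ht₁.between S ht₂ h h'
  refine ⟨ht, fun j hj => ?_⟩
  rintro ⟨⟨y, hy, hsy, hyt⟩, h1, h2⟩
  rcases Finset.mem_insert.1 hj with rfl | hj
  · exact h1 ⟨j, rfl, PlaneSegment.sameLine_refl _, le_rfl⟩
  have hbs := hb.le S (hD.bottom_over hx)
  refine (hD.freeAt hx).2 j hj ⟨⟨y, hy, le_trans hbs hsy, hyt⟩, ?_, h2⟩
  rintro ⟨i, hi, hij, hle⟩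
  have hio := hD.bottom_over hx i hi
  obtain ⟨hj1, hj2⟩ := (PlaneSegment.sameLine_iff _ _ hio.1).1 hij
  have hyj := ((PlaneSegment.mem_carrier_iff _ hj1 _ _).1 hy).2.2
  rw [hi] at hbs hb
  simp only [lowerHeight, upperHeight, Option.elim, EReal.coe_le_coe_iff] at hbs hsy
  have e := hj2 x
  rcases hb with hb | ⟨i', s', hi', hs', hsi, hlt⟩
  · simp only [lowerHeight, upperHeight, Option.elim, EReal.coe_lt_coe_iff] at hb
    linarith
  · cases hs'; cases hi'
    have hsi' := PlaneSegment.sameLine_comm.1 hsi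
    refine h1 ⟨s, rfl, ?_, hle.trans hlt.le⟩
    rw [PlaneSegment.sameLine_iff _ _ hs.1]
    exact ⟨hj1, fun z => (((PlaneSegment.sameLine_iff _ _ hs.1).1 hsi').2 z).trans (hj2 z)⟩

theorem new_face_bottom {R : Finset (Fin n)} {s : Fin n} {D E : Trapezoid n}
    (hD : IsFreeRegion S R D) (hE : IsFreeRegion S (insert s R) E) {x : ℝ} (hxD : D.OverAt x)
    (hxE : E.OverAt x) (h₁ : RunsBelow S D.bottom E.top x) (h₂ : RunsBelow S E.bottom D.top x) : E.bottom = D.bottom ∨ E.bottom = some s := by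
  by_cases h : E.bottom = some s
  · exact Or.inr h
  · refine Or.inl (overlap_bottom_eq hD hE hxD hxE h₁ h₂
      (fun i hi => Finset.mem_insert_of_mem (hD.2.1 i hi).1) fun i hi => ?_)
    rcases Finset.mem_insert.1 (hE.2.1 i hi).1 with rfl | h'
    · exact absurd hi h
    · exact h'

theorem new_face_top {R : Finset (Fin n)} {s : Fin n} {D E : Trapezoid n}
    (hD : IsFreeRegion S R D) (hE : IsFreeRegion S (insert s R) E) {x : ℝ} (hxD : D.OverAt x)
    (hxE : E.OverAt x) (h₁ : RunsBelow S D.bottom E.top x) (h₂ : RunsBelow S E.bottom D.top x) : E.top = D.top ∨ E.top = some s := by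
  by_cases h : E.top = some s
  · exact Or.inr h
  · refine Or.inl (overlap_top_eq hD hE hxD hxE h₁ h₂
      (fun i hi => Finset.mem_insert_of_mem (hD.2.2.1 i hi).1) fun i hi => ?_)
    rcases Finset.mem_insert.1 (hE.2.2.1 i hi).1 with rfl | h'
    · exact absurd hi h
    · exact h'

/-- The bottom of `E` cannot be `s` as well, since nothing runs below itself. The old top is still
present and differs from `s`, so it must run above the new top. -/
theorem new_face_of_top_eq {R : Finset (Fin n)} {s : Fin n} (hs : s ∉ R) {D E : Trapezoid n}
    (hD : IsFreeRegion S R D) (hE : IsFreeRegion S (insert s R) E) {x : ℝ} (hxD : D.OverAt x)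
    (hxE : E.OverAt x) (h₁ : RunsBelow S D.bottom E.top x) (h₂ : RunsBelow S E.bottom D.top x)
    (h : E.top = some s) :
    E.bottom = D.bottom ∧ RunsBelow S (some s) D.top x := by
  have hsx := hE.top_over hxE s h
  have hf := hE.freeAt hxE
  have hb : E.bottom = D.bottom := by
    rcases new_face_bottom hD hE hxD hxE h₁ h₂ with hb | hb
    · exact hb
    · rw [h, hb] at hf
      exact (RunsBelow.asymm S hsx hf.1 hf.1).elim
  refine ⟨hb, ?_⟩
  rcases ht : D.top with _ | t
  · left; simp [lowerHeight, upperHeight]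
  · have htR := (hD.2.2.1 t ht).1
    obtain ⟨i, hi, h3⟩ := hf.top_runsBelow (hE.bottom_over hxE)
      (Finset.mem_insert_of_mem htR) (hD.top_over hxD t ht) (ht ▸ h₂)
    rw [h] at hi; cases hi
    rcases h3 with rfl | h3
    · exact absurd htR hs
    · exact h3

theorem new_face_of_bottom_eq {R : Finset (Fin n)} {s : Fin n} (hs : s ∉ R) {D E : Trapezoid n}
    (hD : IsFreeRegion S R D) (hE : IsFreeRegion S (insert s R) E) {x : ℝ} (hxD : D.OverAt x)
    (hxE : E.OverAt x) (h₁ : RunsBelow S D.bottom E.top x) (h₂ : RunsBelow S E.bottom D.top x)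
    (h : E.bottom = some s) :
    E.top = D.top ∧ RunsBelow S D.bottom (some s) x := by
  have hsx := hE.bottom_over hxE s h
  have hf := hE.freeAt hxE
  have hb : E.top = D.top := by
    rcases new_face_top hD hE hxD hxE h₁ h₂ with hb | hb
    · exact hb
    · rw [h, hb] at hf
      exact (RunsBelow.asymm S hsx hf.1 hf.1).elim
  refine ⟨hb, ?_⟩
  rcases ht : D.bottom with _ | t
  · left; simp [lowerHeight, upperHeight]
  · have htR := (hD.2.1 t ht).1
    obtain ⟨i, hi, h3⟩ := hf.runsBelow_bottom
      (Finset.mem_insert_of_mem htR) (hD.bottom_over hxD t ht) (ht ▸ h₁)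
    rw [h] at hi; cases hi
    rcases h3 with rfl | h3
    · exact absurd htR hs
    · exact h3

/-- Two new faces with the old bottom and top, both overlapping the old face `D`, are equal unless
the new segment interferes with `D` between them. -/
theorem exists_interferes_between {R : Finset (Fin n)} {s : Fin n} {D E F : Trapezoid n}
    (hD : IsFreeRegion S R D) (hE : E ∈ trapezoidation S (insert s R))
    (hF : F ∈ trapezoidation S (insert s R)) (hbE : E.bottom = D.bottom) (htE : E.top = D.top)
    (hbF : F.bottom = D.bottom) (htF : F.top = D.top) {x y : ℝ} (hxy : x ≤ y) (hxE : E.OverAt x)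
    (hyF : F.OverAt y) (hxD : D.OverAt x) (hyD : D.OverAt y) (hne : E ≠ F) :
    ∃ z, x < z ∧ z < y ∧ D.OverAt z ∧ Interferes S D.bottom D.top z s := by
  by_contra hc
  push Not at hc
  refine hne (face_eq_of_free_between hE hF (hbF.trans hbE.symm) (htF.trans htE.symm) hxy hxE hyF
    fun z h h' => ?_)
  have hz := hxD.between hyD h.le h'.le
  rw [hbE, htE]
  refine ⟨(hD.freeAt hz).1, fun j hj => ?_⟩
  rcases Finset.mem_insert.1 hj with rfl | hj
  · exact hc z h h' hz
  · exact (hD.freeAt hz).2 j hj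

/-- At most four new faces overlap an old face. -/
theorem new_faces_card_le {R : Finset (Fin n)} {s : Fin n} (hs : s ∉ R) {D : Trapezoid n}
    (hD : IsFreeRegion S R D) (F : Finset (Trapezoid n))
    (hF : ∀ E ∈ F, E ∈ trapezoidation S (insert s R) ∧ D.Overlaps S E) : F.card ≤ 4 := by
  classical
  choose! x hx using fun E hE => (hF E hE).2
  -- The colours: below `s`, above `s`, and, for faces keeping both old boundaries, to the right or
  -- not to the right of a point where `s` interferes with `D`. Each colour occurs at most once.
  let code : Trapezoid n → Fin 4 := fun E =>
    if E.top = some s then 0 else if E.bottom = some s then 1 else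
      if ∃ w, w < x E ∧ D.OverAt w ∧ Interferes S D.bottom D.top w s then 2 else 3
  have main : ∀ E ∈ F, ∀ E' ∈ F, code E = code E' → x E ≤ x E' → E = E' := by
    intro E hE E' hE' hcode hle
    obtain ⟨hxD, hxE, h1, h2⟩ := hx E hE
    obtain ⟨hxD', hxE', h1', h2'⟩ := hx E' hE'
    have hf := (hF E hE).1
    have hf' := (hF E' hE').1
    by_cases ht : E.top = some s
    · have ht' : E'.top = some s := by
        by_contra hc
        simp only [code, ht, hc, if_true, if_false] at hcode
        split_ifs at hcode <;> exact absurd hcode (by decide)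
      obtain ⟨hb, hr⟩ := new_face_of_top_eq hs hD hf.1 hxD hxE h1 h2 ht
      obtain ⟨hb', hr'⟩ := new_face_of_top_eq hs hD hf'.1 hxD' hxE' h1' h2' ht'
      refine face_eq_of_free_between hf hf' (hb'.trans hb.symm) (ht'.trans ht.symm) hle hxE hxE' ?_
      intro z hz hz'
      rw [hb, ht]
      exact free_below_new hD hxD hxD' (hf.1.top_over hxE s ht) (hf'.1.top_over hxE' s ht')
        (ht ▸ h1) (ht' ▸ h1') hr hr' hz.le hz'.le
    have ht' : E'.top ≠ some s := by
      intro hc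
      simp only [code, ht, hc, if_true, if_false] at hcode
      split_ifs at hcode <;> exact absurd hcode (by decide)
    by_cases hb : E.bottom = some s
    · have hb' : E'.bottom = some s := by
        by_contra hc
        simp only [code, ht, ht', hb, hc, if_true, if_false] at hcode
        split_ifs at hcode <;> exact absurd hcode (by decide)
      obtain ⟨ht, hr⟩ := new_face_of_bottom_eq hs hD hf.1 hxD hxE h1 h2 hb
      obtain ⟨ht', hr'⟩ := new_face_of_bottom_eq hs hD hf'.1 hxD' hxE' h1' h2' hb'
      refine face_eq_of_free_between hf hf' (hb'.trans hb.symm) (ht'.trans ht.symm) hle hxE hxE' ?_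
      intro z hz hz'
      rw [ht, hb]
      exact free_above_new hD hxD hxD' (hf.1.bottom_over hxE s hb) (hf'.1.bottom_over hxE' s hb')
        hr hr' (hb ▸ h2) (hb' ▸ h2') hz.le hz'.le
    have hb' : E'.bottom ≠ some s := by
      intro hc
      simp only [code, ht, ht', hb, hc, if_true, if_false] at hcode
      split_ifs at hcode <;> exact absurd hcode (by decide)
    by_contra hne
    have eb := (new_face_bottom hD hf.1 hxD hxE h1 h2).resolve_right hb
    have et := (new_face_top hD hf.1 hxD hxE h1 h2).resolve_right ht
    obtain ⟨z, hz, hz', hzD, hi⟩ := exists_interferes_between hD hf hf' eb et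
      ((new_face_bottom hD hf'.1 hxD' hxE' h1' h2').resolve_right hb')
      ((new_face_top hD hf'.1 hxD' hxE' h1' h2').resolve_right ht') hle hxE hxE' hxD hxD' hne
    -- The point `z` puts `E'` to the right of an interference, hence by equal colours `E` too. Now
    -- `s` interferes on both sides of `x E`, so also at `x E`, where `E` is free.
    have hp' : ∃ w, w < x E' ∧ D.OverAt w ∧ Interferes S D.bottom D.top w s := ⟨z, hz', hzD, hi⟩
    have hp : ∃ w, w < x E ∧ D.OverAt w ∧ Interferes S D.bottom D.top w s := by
      by_contra hc
      simp only [code, ht, ht', hb, hb', if_false, if_pos hp', if_neg hc] at hcode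
      exact absurd hcode (by decide)
    obtain ⟨w, hw, -, hwi⟩ := hp
    have hbad := hwi.between hi hw.le hz.le
    rw [← eb, ← et] at hbad
    exact (hf.1.freeAt hxE).2 s (Finset.mem_insert_self _ _) hbad
  have := Finset.card_le_card_of_injOn (s := F) (t := Finset.univ) code (fun _ _ => Finset.mem_coe.2 (Finset.mem_univ _))
    (fun E hE E' hE' h => (le_total (x E) (x E')).elim (main E hE E' hE' h)
      fun hle => (main E' hE' E hE h.symm hle).symm)
  simpa using this

end Children

/-! ### Termination and cost of depth-first search -/

section DepthFirstSearch

variable {V : Type*} {child : V → V → Prop} {test : V → Prop} {N : Set V} {U : Finset V}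

open Classical in
/-- The elements of `U` that are not marked. -/
noncomputable def unmarked (U : Finset V) (marked : Set V) : Finset V := U.filter (· ∉ marked)

theorem unmarked_card_lt {marked : Set V} {v : V} (hv : v ∈ U) (hm : v ∉ marked) :
    (unmarked U (insert v marked)).card < (unmarked U marked).card := by
  refine Finset.card_lt_card ((Finset.ssubset_iff_of_subset fun w hw => ?_).2 ⟨v, ?_, ?_⟩)
  · simp only [unmarked, Finset.mem_filter, Set.mem_insert_iff, not_or] at hw ⊢
    exact ⟨hw.1, hw.2.2⟩
  · simp [unmarked, hv, hm]
  · simp [unmarked]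

/-- The search examines, apart from the initial stack, at most `k` nodes for each visited node. -/
theorem DFSRun.steps_le (hN : ∀ v ∈ N, ∀ w, child v w → w ∈ N) (hU : ∀ v ∈ N, test v → v ∈ U)
    {k : ℕ} (hk : ∀ v ∈ N, ∀ l : List V, l.Nodup → (∀ w ∈ l, child v w) → l.length ≤ k)
    {stack : List V} {marked : Set V} {out : List V} {t : ℕ}
    (h : DFSRun child test stack marked out t) (hs : ∀ v ∈ stack, v ∈ N) :
    t ≤ stack.length + k * (unmarked U marked).card := by
  induction h with
  | halt => simp
  | drop _ _ ih =>
    have := ih fun w hw => hs w (List.mem_cons_of_mem _ hw)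
    simp only [List.length_cons]; omega
  | @report v stack marked out t hm ht _ _ ih =>
    have h1 := ih fun w hw => hs w (List.mem_cons_of_mem _ hw)
    have h2 := unmarked_card_lt (hU v (hs v (by simp)) ht) hm
    have h3 := Nat.mul_le_mul_left k h2
    simp only [List.length_cons]
    rw [Nat.mul_succ] at h3; omega
  -- The at most `k` pushed children are paid for by the node of `U` that becomes marked.
  | @descend v stack marked out t children hm ht _ hnd hc _ ih =>
    have hv := hs v (by simp)
    have h1 := ih fun w hw => by
      rcases List.mem_append.1 hw with hw | hw
      · exact hN v hv w ((hc w).1 hw)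
      · exact hs w (List.mem_cons_of_mem _ hw)
    have h2 := unmarked_card_lt (hU v hv ht) hm
    have h3 := Nat.mul_le_mul_left k h2
    have h4 := hk v hv children hnd fun w hw => (hc w).1 hw
    simp only [List.length_cons, List.length_append] at h1 ⊢
    rw [Nat.mul_succ] at h3; omega

/-- A visit marks a node of `U`, and a drop shortens the stack without marking. So the induction is
on the number of unmarked nodes of `U`, and then on the stack. -/
theorem DFSRun.exists_run (hN : ∀ v ∈ N, ∀ w, child v w → w ∈ N)
    (hU : ∀ v ∈ N, test v → v ∈ U) (hfin : ∀ v ∈ N, {w | child v w}.Finite)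
    (stack : List V) (marked : Set V) (hs : ∀ v ∈ stack, v ∈ N) :
    ∃ out t, DFSRun child test stack marked out t := by
  induction hm : (unmarked U marked).card using Nat.strong_induction_on
    generalizing stack marked with
  | _ m ihm =>
  induction stack with
  | nil => exact ⟨[], 0, .halt _⟩
  | cons v stack ih =>
    have hs' : ∀ w ∈ stack, w ∈ N := fun w hw => hs w (List.mem_cons_of_mem _ hw)
    have hv := hs v (by simp)
    by_cases hd : v ∈ marked ∨ ¬ test v
    · obtain ⟨out, t, h⟩ := ih hs'
      exact ⟨out, t + 1, .drop hd h⟩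
    push Not at hd
    have hlt : (unmarked U (insert v marked)).card < m := hm ▸ unmarked_card_lt (hU v hv hd.2) hd.1
    by_cases hc : ∀ w, ¬ child v w
    · obtain ⟨out, t, h⟩ := ihm _ hlt stack (insert v marked) hs' rfl
      exact ⟨_, _, .report hd.1 hd.2 hc h⟩
    · push Not at hc
      obtain ⟨w, hw⟩ := hc
      have hmem : ∀ w, w ∈ (hfin v hv).toFinset.toList ↔ child v w := by simp
      obtain ⟨out, t, h⟩ := ihm _ hlt ((hfin v hv).toFinset.toList ++ stack) (insert v marked)
        (fun u hu => (List.mem_append.1 hu).elim (fun h => hN v hv u ((hmem u).1 h)) (hs' u)) rfl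
      exact ⟨_, _, .descend _ hd.1 hd.2 (List.ne_nil_of_mem ((hmem w).2 hw))
        (Finset.nodup_toList _) hmem h⟩

end DepthFirstSearch

/-! ### Degrees and query cost in the search DAG -/

section SearchDag

variable {n : ℕ} {S : Fin n → PlaneSegment} {σ : Equiv.Perm (Fin n)}

theorem insertedFirst_mono {m m' : ℕ} (h : m ≤ m') : insertedFirst σ m ⊆ insertedFirst σ m' := by
  intro j hj
  simp only [insertedFirst, Finset.mem_filter, Finset.mem_univ, true_and] at hj ⊢
  omega

theorem notMem_insertedFirst (m : Fin n) : σ m ∉ insertedFirst σ m := by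
  simp [insertedFirst]

theorem insertedFirst_succ (m : Fin n) :
    insertedFirst σ (m + 1) = insert (σ m) (insertedFirst σ m) := by
  ext j
  simp only [insertedFirst, Finset.mem_filter, Finset.mem_univ, true_and, Finset.mem_insert]
  rw [← Equiv.symm_apply_eq, Fin.ext_iff]
  omega

theorem insertedFirst_eq_erase (m : Fin n) :
    insertedFirst σ m = (insertedFirst σ (m + 1)).erase (σ m) := by
  rw [insertedFirst_succ, Finset.erase_insert (notMem_insertedFirst m)]

/-- The faces of all trapezoidations that occur during the insertion. -/
def dagNodes (S : Fin n → PlaneSegment) (σ : Equiv.Perm (Fin n)) : Set (Trapezoid n) :=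
  {D | ∃ m ≤ n, D ∈ trapezoidation S (insertedFirst σ m)}

theorem plane_mem_trapezoidation : Trapezoid.plane n ∈ trapezoidation S ∅ := by
  refine ⟨⟨?_, ?_, ?_, ?_⟩, ?_⟩
  · simp [Trapezoid.plane]
  · simp [Trapezoid.plane]
  · simp [Trapezoid.plane]
  · intro x _ _
    refine ⟨Or.inl ?_, by simp⟩
    simp [Trapezoid.plane, lowerHeight, upperHeight]
  · intro D _ hb ht hl hr
    ext1
    · exact hb
    · exact ht
    · exact le_bot_iff.1 hl
    · exact top_le_iff.1 hr

theorem plane_mem_dagNodes : Trapezoid.plane n ∈ dagNodes S σ := by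
  refine ⟨0, Nat.zero_le _, ?_⟩
  have : insertedFirst σ 0 = ∅ := by simp [insertedFirst]
  rw [this]
  exact plane_mem_trapezoidation

theorem TSDChild.mem_dagNodes {D E : Trapezoid n} (h : TSDChild S σ D E) : E ∈ dagNodes S σ := by
  obtain ⟨m, hm, -, hE, -⟩ := h
  exact ⟨m + 1, hm, hE.2⟩

/-- By `face_of_face_superset`, `D` is destroyed by a single insertion, so all its children arise in
the same step. -/
theorem children_card_le (D : Trapezoid n) (F : Finset (Trapezoid n))
    (hF : ∀ E ∈ F, TSDChild S σ D E) : F.card ≤ 4 := by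
  rcases F.eq_empty_or_nonempty with rfl | ⟨E, hE⟩
  · simp
  obtain ⟨m, hm, hD, -, -⟩ := hF E hE
  refine new_faces_card_le (notMem_insertedFirst (σ := σ) ⟨m, hm⟩) hD.1.1 F fun E' hE' => ?_
  obtain ⟨m', hm', hD', hE', ho⟩ := hF E' hE'
  have key : m = m' := by
    rcases lt_trichotomy m m' with h | h | h
    · exact absurd (face_of_face_superset (insertedFirst_mono (Nat.le_succ m))
        (insertedFirst_mono h) hD.1 hD'.1) hD.2
    · exact h
    · exact absurd (face_of_face_superset (insertedFirst_mono (Nat.le_succ m'))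
        (insertedFirst_mono h) hD'.1 hD.1) hD'.2
  subst key
  rw [← insertedFirst_succ]
  exact ⟨hE'.2, ho⟩

theorem children_finite (D : Trapezoid n) : {E | TSDChild S σ D E}.Finite := by
  by_contra h
  obtain ⟨F, hF, hc⟩ := Set.Infinite.exists_subset_card_eq h 5
  have := children_card_le D F fun E hE => hF hE
  omega

theorem children_length_le (D : Trapezoid n) (l : List (Trapezoid n)) (hl : l.Nodup)
    (h : ∀ E ∈ l, TSDChild S σ D E) : l.length ≤ 4 := by
  classical
  rw [← List.toFinset_card_of_nodup hl]
  exact children_card_le D _ fun E hE => h E (List.mem_toFinset.1 hE)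

variable {q : Set (ℝ × ℝ)} {U : Finset (Trapezoid n)}

theorem exists_queryHaltsIn (hU : ∀ D ∈ dagNodes S σ, (D.region S ∩ q).Nonempty → D ∈ U) :
    ∃ t, TSDQueryHaltsIn S σ q t := by
  obtain ⟨out, t, h⟩ := DFSRun.exists_run (child := TSDChild S σ)
    (fun _ _ _ h => TSDChild.mem_dagNodes h) hU (fun D _ => children_finite D)
    [Trapezoid.plane n] ∅ (by simpa using plane_mem_dagNodes)
  exact ⟨t, out, h⟩

theorem TSDQueryHaltsIn.le (hU : ∀ D ∈ dagNodes S σ, (D.region S ∩ q).Nonempty → D ∈ U) {t : ℕ}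
    (h : TSDQueryHaltsIn S σ q t) : t ≤ 1 + 4 * U.card := by
  obtain ⟨out, h⟩ := h
  simpa [unmarked] using DFSRun.steps_le (fun _ _ _ h => TSDChild.mem_dagNodes h) hU
    (fun D _ => children_length_le D) h (by simpa using plane_mem_dagNodes)

end SearchDag

/-! ### Faces that meet the query, and what their removal depends on -/

section QueryFaces

variable {n : ℕ} {S : Fin n → PlaneSegment} {c y₀ y₁ : ℝ}

open Filter Topology

theorem PlaneSegment.continuous_height (s : PlaneSegment) : Continuous s.height := by
  unfold PlaneSegment.height; fun_prop

theorem continuous_lowerHeight (b : Option (Fin n)) : Continuous (lowerHeight S b) := by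
  rcases b with _ | b
  · exact continuous_const
  · exact continuous_coe_real_ereal.comp (S b).continuous_height

theorem continuous_upperHeight (b : Option (Fin n)) : Continuous (upperHeight S b) := by
  rcases b with _ | b
  · exact continuous_const
  · exact continuous_coe_real_ereal.comp (S b).continuous_height

open Classical in
/-- The segments with index in `R` that meet `q`. -/
noncomputable def hitBy (S : Fin n → PlaneSegment) (R : Finset (Fin n)) (q : Set (ℝ × ℝ)) :
    Finset (Fin n) :=
  R.filter fun j => ((S j).carrier ∩ q).Nonempty

/-- The faces of a trapezoidation whose closed region meets `q`. -/
def queryFaces (S : Fin n → PlaneSegment) (R : Finset (Fin n)) (q : Set (ℝ × ℝ)) :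
    Set (Trapezoid n) :=
  {D | D ∈ trapezoidation S R ∧ (D.region S ∩ q).Nonempty}

/-- The filter stands for one side of the line x = c. A bottom that is at height at least `y₀` over
`c` meets the query and determines its face on that side. All other faces get the value `none`,
which accounts for the extra one. -/
theorem queryFaces_side_encard_le (R : Finset (Fin n)) (l : Filter ℝ) [l.NeBot] (hl : l ≤ 𝓝 c) :
    {D ∈ queryFaces S R (verticalSegment c y₀ y₁) | ∀ᶠ x in l, D.OverAt x}.encard ≤
      (hitBy S R (verticalSegment c y₀ y₁)).card + 1 := by
  classical
  let f : Trapezoid n → Option (Fin n) := fun D =>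
    if (y₀ : EReal) ≤ lowerHeight S D.bottom c then D.bottom else none
  have hmaps : Set.MapsTo f
      {D ∈ queryFaces S R (verticalSegment c y₀ y₁) | ∀ᶠ x in l, D.OverAt x}
      (Finset.insertNone (hitBy S R (verticalSegment c y₀ y₁)) : Finset (Option (Fin n))) := by
    rintro D ⟨⟨hD, ⟨x, y⟩, ⟨h1, h2, h3, h4⟩, h5, h6, h7⟩, -⟩
    simp only at h1 h2 h3 h4 h5 h6 h7
    subst h5
    simp only [Finset.mem_coe, Finset.mem_insertNone]
    intro i hi
    simp only [f, Option.mem_def] at hi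
    split_ifs at hi with hy
    · obtain ⟨hiR, hsp⟩ := hD.1.2.1 i hi
      rw [hi] at hy h3
      simp only [lowerHeight, Option.elim, EReal.coe_le_coe_iff] at hy h3
      exact Finset.mem_filter.2 ⟨hiR, (x, (S i).height x), (hsp.over h1 h2).mem, rfl, hy,
        h3.trans h7⟩
  have hinj : Set.InjOn f
      {D ∈ queryFaces S R (verticalSegment c y₀ y₁) | ∀ᶠ x in l, D.OverAt x} := by
    rintro D ⟨⟨hD, ⟨x, y⟩, ⟨h1, h2, h3, h4⟩, h5, h6, h7⟩, hl₁⟩ E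
      ⟨⟨hE, ⟨x', y'⟩, ⟨h1', h2', h3', h4'⟩, h5', h6', h7'⟩, hl₂⟩ hf
    simp only at h1 h2 h3 h4 h5 h6 h7 h1' h2' h3' h4' h5' h6' h7'
    subst h5
    subst h5'
    obtain ⟨z, hz₁, hz₂⟩ := (hl₁.and hl₂).exists
    have hb : ∀ {b : Option (Fin n)}, (y₀ : EReal) ≤ lowerHeight S b x' → b ≠ none := by
      rintro b h rfl
      simp [lowerHeight] at h
    by_cases hy : (y₀ : EReal) ≤ lowerHeight S D.bottom x'
    · by_cases hy' : (y₀ : EReal) ≤ lowerHeight S E.bottom x'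
      · simp only [f, if_pos hy, if_pos hy'] at hf
        exact face_eq_of_bottom_eq hD hE hz₁ hz₂ hf
      · simp only [f, if_pos hy, if_neg hy'] at hf
        exact absurd hf (hb hy)
    · by_cases hy' : (y₀ : EReal) ≤ lowerHeight S E.bottom x'
      · simp only [f, if_neg hy, if_pos hy'] at hf
        exact absurd hf.symm (hb hy')
      · rw [not_le] at hy hy'
        -- Both bottoms are strictly below `y₀` over `x'` and both tops are not, so by continuity
        -- the two faces overlap near `x'`.
        have e1 : ∀ᶠ z in 𝓝 x', lowerHeight S D.bottom z < upperHeight S E.top z :=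
          (continuous_lowerHeight _).continuousAt.eventually_lt
            (continuous_upperHeight _).continuousAt
            (hy.trans_le ((EReal.coe_le_coe_iff.2 h6').trans h4'))
        have e2 : ∀ᶠ z in 𝓝 x', lowerHeight S E.bottom z < upperHeight S D.top z :=
          (continuous_lowerHeight _).continuousAt.eventually_lt
            (continuous_upperHeight _).continuousAt
            (hy'.trans_le ((EReal.coe_le_coe_iff.2 h6).trans h4))
        obtain ⟨w, ⟨hw₁, hw₂⟩, hw₃, hw₄⟩ :=
          ((hl₁.and hl₂).and ((e1.and e2).filter_mono hl)).exists
        exact face_eq_of_overlap hD hE hw₁ hw₂ (Or.inl hw₃) (Or.inl hw₄)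
  have := Set.encard_le_encard_of_injOn hmaps hinj
  rw [Set.encard_coe_eq_coe_finsetCard, Finset.card_insertNone] at this
  exact_mod_cast this

/-- A closed region meeting the line x = c reaches to its right if its left wall is at `c`, and to
its left otherwise. -/
theorem queryFaces_encard_le (R : Finset (Fin n)) :
    (queryFaces S R (verticalSegment c y₀ y₁)).encard ≤
      (2 * ((hitBy S R (verticalSegment c y₀ y₁)).card + 1) : ℕ) := by
  have hsub : queryFaces S R (verticalSegment c y₀ y₁) ⊆
      {D ∈ queryFaces S R (verticalSegment c y₀ y₁) | ∀ᶠ x in 𝓝[<] c, D.OverAt x} ∪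
      {D ∈ queryFaces S R (verticalSegment c y₀ y₁) | ∀ᶠ x in 𝓝[>] c, D.OverAt x} := by
    intro D hD
    obtain ⟨hDf, ⟨x, y⟩, ⟨h1, h2, -⟩, h5, -⟩ := id hD
    simp only at h1 h2 h5
    subst h5
    have hc : ContinuousAt (fun z : ℝ => (z : EReal)) x := continuous_coe_real_ereal.continuousAt
    rcases h1.eq_or_lt with h | h
    · right
      refine ⟨hD, ?_⟩
      have : (x : EReal) < D.right := h ▸ hDf.1.1
      filter_upwards [(hc.eventually_lt continuousAt_const this).filter_mono nhdsWithin_le_nhds,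
        self_mem_nhdsWithin] with z h3 h4
      exact ⟨h1.trans_lt (EReal.coe_lt_coe_iff.2 h4), h3⟩
    · left
      refine ⟨hD, ?_⟩
      filter_upwards [(continuousAt_const.eventually_lt hc h).filter_mono nhdsWithin_le_nhds,
        self_mem_nhdsWithin] with z h3 h4
      exact ⟨h3, (EReal.coe_lt_coe_iff.2 h4).trans_le h2⟩
  refine (Set.encard_le_encard hsub).trans ((Set.encard_union_le _ _).trans ?_)
  refine (add_le_add (queryFaces_side_encard_le R _ nhdsWithin_le_nhds)
    (queryFaces_side_encard_le R _ nhdsWithin_le_nhds)).trans ?_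
  norm_cast
  omega

theorem queryFaces_finite (R : Finset (Fin n)) :
    (queryFaces S R (verticalSegment c y₀ y₁)).Finite :=
  Set.finite_of_encard_le_coe (queryFaces_encard_le R)

theorem queryFaces_card_le (R : Finset (Fin n)) :
    (queryFaces_finite (S := S) (c := c) (y₀ := y₀) (y₁ := y₁) R).toFinset.card ≤
      2 * ((hitBy S R (verticalSegment c y₀ y₁)).card + 1) := by
  have := queryFaces_encard_le (S := S) (c := c) (y₀ := y₀) (y₁ := y₁) R
  rw [(queryFaces_finite R).encard_eq_coe_toFinset_card] at this
  exact_mod_cast this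

open Classical in
/-- Every face is lost by the removal of at most four segments. -/
theorem removals_card_le {R : Finset (Fin n)} {E : Trapezoid n} (hE : E ∈ trapezoidation S R) :
    (R.filter fun s => E ∉ trapezoidation S (R.erase s)).card ≤ 4 := by
  -- `L` and `M` collect the segments that are solely responsible for the left and the right wall.
  let L := R.filter fun s => ∃ l < E.left, IsFreeRegion S (R.erase s) ⟨E.bottom, E.top, l, E.right⟩
  let M := R.filter fun s => ∃ r, E.right < r ∧
    IsFreeRegion S (R.erase s) ⟨E.bottom, E.top, E.left, r⟩
  have hL : L.card ≤ 1 := by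
    rw [Finset.card_le_one]
    intro s hs s' hs'
    by_contra hne
    obtain ⟨-, l, hl, hf⟩ := Finset.mem_filter.1 hs
    obtain ⟨-, l', hl', hf'⟩ := Finset.mem_filter.1 hs'
    -- The shorter of the two prolongations is free for all of `R`, because every segment survives
    -- one of the two removals. This contradicts the maximality of `E`.
    have := hE.2 ⟨E.bottom, E.top, max l l', E.right⟩ ⟨(max_lt hl hl').trans hE.1.1,
      fun i hi => ⟨(hE.1.2.1 i hi).1, (hE.1.2.1 i hi).2.1,
        (hf.2.1 i hi).2.2.1.trans (le_max_left _ _), (hE.1.2.1 i hi).2.2.2⟩,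
      fun i hi => ⟨(hE.1.2.2.1 i hi).1, (hE.1.2.2.1 i hi).2.1,
        (hf.2.2.1 i hi).2.2.1.trans (le_max_left _ _), (hE.1.2.2.1 i hi).2.2.2⟩,
      fun x h1 h2 => ?_⟩ rfl rfl (max_lt hl hl').le le_rfl
    · exact (max_lt hl hl').ne (congrArg Trapezoid.left this)
    · have g := hf.2.2.2 x ((le_max_left _ _).trans_lt h1) h2
      have g' := hf'.2.2.2 x ((le_max_right _ _).trans_lt h1) h2
      refine ⟨g.1, fun j hj => ?_⟩
      by_cases hjs : j = s
      · exact g'.2 j (Finset.mem_erase.2 ⟨hjs ▸ hne, hj⟩)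
      · exact g.2 j (Finset.mem_erase.2 ⟨hjs, hj⟩)
  have hM : M.card ≤ 1 := by
    rw [Finset.card_le_one]
    intro s hs s' hs'
    by_contra hne
    obtain ⟨-, r, hr, hf⟩ := Finset.mem_filter.1 hs
    obtain ⟨-, r', hr', hf'⟩ := Finset.mem_filter.1 hs'
    have := hE.2 ⟨E.bottom, E.top, E.left, min r r'⟩ ⟨hE.1.1.trans (lt_min hr hr'),
      fun i hi => ⟨(hE.1.2.1 i hi).1, (hE.1.2.1 i hi).2.1,
        (hE.1.2.1 i hi).2.2.1, (min_le_left _ _).trans (hf.2.1 i hi).2.2.2⟩,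
      fun i hi => ⟨(hE.1.2.2.1 i hi).1, (hE.1.2.2.1 i hi).2.1,
        (hE.1.2.2.1 i hi).2.2.1, (min_le_left _ _).trans (hf.2.2.1 i hi).2.2.2⟩,
      fun x h1 h2 => ?_⟩ rfl rfl le_rfl (lt_min hr hr').le
    · exact (lt_min hr hr').ne' (congrArg Trapezoid.right this)
    · have g := hf.2.2.2 x h1 (lt_of_lt_of_le h2 (min_le_left _ _))
      have g' := hf'.2.2.2 x h1 (lt_of_lt_of_le h2 (min_le_right _ _))
      refine ⟨g.1, fun j hj => ?_⟩
      by_cases hjs : j = s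
      · exact g'.2 j (Finset.mem_erase.2 ⟨hjs ▸ hne, hj⟩)
      · exact g.2 j (Finset.mem_erase.2 ⟨hjs, hj⟩)
  have hsub : (R.filter fun s => E ∉ trapezoidation S (R.erase s)) ⊆
      (E.bottom.toFinset ∪ E.top.toFinset) ∪ (L ∪ M) := by
    intro s hs
    obtain ⟨hsR, hs⟩ := Finset.mem_filter.1 hs
    by_contra hc
    simp only [Finset.mem_union, Option.mem_toFinset, Option.mem_def, not_or] at hc
    obtain ⟨⟨hb, ht⟩, hsL, hsM⟩ := hc
    have hfree : IsFreeRegion S (R.erase s) E := hE.1.mono (Finset.erase_subset _ _)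
      (fun i hi => Finset.mem_erase.2 ⟨fun e => hb (e ▸ hi), (hE.1.2.1 i hi).1⟩)
      (fun i hi => Finset.mem_erase.2 ⟨fun e => ht (e ▸ hi), (hE.1.2.2.1 i hi).1⟩)
    refine hs ⟨hfree, fun D hD hDb hDt hDl hDr => ?_⟩
    ext1
    · exact hDb
    · exact hDt
    · by_contra hne
      -- `D` may be longer on the right as well; cutting it off at `E.right` leaves a witness for
      -- `L`.
      refine hsL (Finset.mem_filter.2 ⟨hsR, D.left, lt_of_le_of_ne hDl hne,
        hDl.trans_lt hE.1.1, fun i hi => ?_, fun i hi => ?_, fun x h1 h2 => ?_⟩)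
      · have := hD.2.1 i (hDb.trans hi)
        exact ⟨this.1, this.2.1, this.2.2.1, hDr.trans this.2.2.2⟩
      · have := hD.2.2.1 i (hDt.trans hi)
        exact ⟨this.1, this.2.1, this.2.2.1, hDr.trans this.2.2.2⟩
      · have := hD.2.2.2 x h1 (lt_of_lt_of_le h2 hDr)
        rwa [hDb, hDt] at this
    · by_contra hne
      refine hsM (Finset.mem_filter.2 ⟨hsR, D.right, lt_of_le_of_ne hDr (Ne.symm hne),
        hE.1.1.trans_le hDr, fun i hi => ?_, fun i hi => ?_, fun x h1 h2 => ?_⟩)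
      · have := hD.2.1 i (hDb.trans hi)
        exact ⟨this.1, this.2.1, this.2.2.1.trans hDl, this.2.2.2⟩
      · have := hD.2.2.1 i (hDt.trans hi)
        exact ⟨this.1, this.2.1, this.2.2.1.trans hDl, this.2.2.2⟩
      · have := hD.2.2.2 x (hDl.trans_lt h1) h2
        rwa [hDb, hDt] at this
  have hopt : ∀ o : Option (Fin n), o.toFinset.card ≤ 1 := by
    rintro (_ | o) <;> simp
  have h1 := Finset.card_le_card hsub
  have h2 := Finset.card_union_le (E.bottom.toFinset ∪ E.top.toFinset) (L ∪ M)
  have h3 := Finset.card_union_le E.bottom.toFinset E.top.toFinset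
  have h4 := Finset.card_union_le L M
  have h5 := hopt E.bottom
  have h6 := hopt E.top
  omega

end QueryFaces

/-! ### Backward analysis -/

section Average

variable {n : ℕ}

theorem insertedFirst_eq_map (σ : Equiv.Perm (Fin n)) (m : ℕ) :
    insertedFirst σ m = (Finset.univ.filter fun i : Fin n => (i : ℕ) < m).map σ.toEmbedding := by
  ext j
  simp only [insertedFirst, Finset.mem_filter, Finset.mem_univ, true_and, Finset.mem_map,
    Equiv.toEmbedding_apply]
  constructor
  · intro h
    exact ⟨σ.symm j, h, by simp⟩
  · rintro ⟨i, h, rfl⟩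
    simpa using h

/-- Backward analysis: in a random order, the last of the first `m + 1` inserted segments is
a uniformly random one of them. -/
theorem sum_last_inserted (g : Finset (Fin n) → Fin n → ℝ) (m : Fin n) :
    ((m : ℝ) + 1) * ∑ σ, g (insertedFirst σ (m + 1)) (σ m) =
      ∑ σ, ∑ s ∈ insertedFirst σ (m + 1), g (insertedFirst σ (m + 1)) s := by
  have hcard : (Finset.univ.filter fun i : Fin n => (i : ℕ) < m + 1).card = m + 1 := by
    have : (Finset.univ.filter fun i : Fin n => (i : ℕ) < m + 1) = Finset.Iic m := by
      ext i
      simp only [Finset.mem_filter, Finset.mem_univ, true_and, Finset.mem_Iic, Fin.le_def]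
      omega
    rw [this, Fin.card_Iic]
  have h1 : ∀ σ : Equiv.Perm (Fin n), ∑ s ∈ insertedFirst σ (m + 1), g (insertedFirst σ (m + 1)) s =
      ∑ i ∈ Finset.univ.filter (fun i : Fin n => (i : ℕ) < m + 1),
        g (insertedFirst σ (m + 1)) (σ i) := by
    intro σ
    conv_lhs => rw [insertedFirst_eq_map, Finset.sum_map, ← insertedFirst_eq_map]
    rfl
  simp only [h1]
  rw [Finset.sum_comm]
  have h2 : ∀ i ∈ Finset.univ.filter (fun i : Fin n => (i : ℕ) < m + 1),
      ∑ σ : Equiv.Perm (Fin n), g (insertedFirst σ (m + 1)) (σ i) =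
        ∑ σ : Equiv.Perm (Fin n), g (insertedFirst σ (m + 1)) (σ m) := by
    intro i hi
    have hi' := (Finset.mem_filter.1 hi).2
    -- Exchanging the positions `i` and `m`, both among the first m + 1, permutes the orders without
    -- changing the inserted set.
    rw [← Equiv.sum_comp (Equiv.mulRight (Equiv.swap i m))]
    refine Finset.sum_congr rfl fun σ _ => ?_
    have e1 : insertedFirst (σ * Equiv.swap i m) (m + 1) = insertedFirst σ (m + 1) := by
      ext j
      simp only [insertedFirst, Finset.mem_filter, Finset.mem_univ, true_and]
      have : (σ * Equiv.swap i m).symm j = Equiv.swap i m (σ.symm j) := by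
        simp [Equiv.symm_apply_eq]
      rw [this, Equiv.swap_apply_def]
      split_ifs with h h'
      · rw [h]; omega
      · rw [h']; omega
      · rfl
    simp [e1]
  rw [Finset.sum_congr rfl h2, Finset.sum_const, hcard, nsmul_eq_mul]
  push_cast
  rfl

end Average

/-! ### Expected number of nodes that meet the query -/

section Expectation

variable {n : ℕ} (S : Fin n → PlaneSegment) (c y₀ y₁ : ℝ)

open Classical in
/-- The faces of the trapezoidation of `R` that meet the query and are lost if `s` is removed. -/
noncomputable def lostFaces (R : Finset (Fin n)) (s : Fin n) : Finset (Trapezoid n) :=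
  (queryFaces_finite (S := S) (c := c) (y₀ := y₀) (y₁ := y₁) R).toFinset.filter
    fun D => D ∉ trapezoidation S (R.erase s)

open Classical in
-- Double counting of pairs of a face and a segment whose removal destroys it: four for each of the
-- at most 2(k_R + 1) faces.
theorem sum_lostFaces_le (R : Finset (Fin n)) :
    ∑ s ∈ R, (lostFaces S c y₀ y₁ R s).card ≤
      8 * ((hitBy S R (verticalSegment c y₀ y₁)).card + 1) := by
  have h1 : ∑ s ∈ R, (lostFaces S c y₀ y₁ R s).card =
      ∑ D ∈ (queryFaces_finite (S := S) (c := c) (y₀ := y₀) (y₁ := y₁) R).toFinset,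
        (R.filter fun s => D ∉ trapezoidation S (R.erase s)).card := by
    simp only [lostFaces, Finset.card_filter]
    exact Finset.sum_comm
  rw [h1]
  refine (Finset.sum_le_card_nsmul _ _ 4 fun D hD => ?_).trans ?_
  · exact removals_card_le ((Set.Finite.mem_toFinset _).1 hD).1
  · have := queryFaces_card_le (S := S) (c := c) (y₀ := y₀) (y₁ := y₁) R
    rw [smul_eq_mul]
    omega

open Classical in
/-- A finite set that contains all nodes of the search DAG whose region meets the query. -/
noncomputable def queryNodes (σ : Equiv.Perm (Fin n)) : Finset (Trapezoid n) :=
  (queryFaces_finite (S := S) (c := c) (y₀ := y₀) (y₁ := y₁) ∅).toFinset ∪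
    Finset.univ.biUnion fun m : Fin n => lostFaces S c y₀ y₁ (insertedFirst σ (m + 1)) (σ m)

variable {S c y₀ y₁}

/-- Going back in time from a moment at which the face exists leads to the insertion that created
it, or to the empty set. -/
theorem mem_queryNodes {σ : Equiv.Perm (Fin n)} {D : Trapezoid n} (hD : D ∈ dagNodes S σ)
    (hq : (D.region S ∩ verticalSegment c y₀ y₁).Nonempty) : D ∈ queryNodes S c y₀ y₁ σ := by
  classical
  obtain ⟨m, hm, hD⟩ := hD
  unfold queryNodes
  induction m with
  | zero =>
    have : insertedFirst σ 0 = ∅ := by simp [insertedFirst]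
    rw [this] at hD
    exact Finset.mem_union_left _ ((Set.Finite.mem_toFinset _).2 ⟨hD, hq⟩)
  | succ m ih =>
    by_cases h : D ∈ trapezoidation S (insertedFirst σ m)
    · exact ih (Nat.le_of_succ_le hm) h
    · refine Finset.mem_union_right _ (Finset.mem_biUnion.2 ⟨⟨m, hm⟩, Finset.mem_univ _, ?_⟩)
      refine Finset.mem_filter.2 ⟨(Set.Finite.mem_toFinset _).2 ⟨hD, hq⟩, ?_⟩
      rw [← insertedFirst_eq_erase]
      exact h

theorem queryNodes_card_le (σ : Equiv.Perm (Fin n)) :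
    (queryNodes S c y₀ y₁ σ).card ≤
      2 + ∑ m : Fin n, (lostFaces S c y₀ y₁ (insertedFirst σ (m + 1)) (σ m)).card := by
  classical
  refine (Finset.card_union_le _ _).trans (add_le_add ?_ Finset.card_biUnion_le)
  exact (queryFaces_card_le ∅).trans (by simp [hitBy])

open Classical in
-- Applying `sum_last_inserted` a second time, to the indicator of `K`, turns the average of k_R/(m
-- + 1) back into the event that `σ m` lies in `K`. Since `σ` is a bijection, these events sum to
-- `K.card`.
theorem sum_queryNodes_card_le :
    ∑ σ : Equiv.Perm (Fin n), ((queryNodes S c y₀ y₁ σ).card : ℝ) ≤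
      n.factorial * (2 + 8 * ((hitBy S Finset.univ (verticalSegment c y₀ y₁)).card +
        ∑ m : Fin n, 1 / ((m : ℝ) + 1))) := by
  set K := hitBy S Finset.univ (verticalSegment c y₀ y₁) with hK
  have hhit : ∀ R : Finset (Fin n), ((hitBy S R (verticalSegment c y₀ y₁)).card : ℝ) =
      ∑ s ∈ R, if s ∈ K then (1 : ℝ) else 0 := by
    intro R
    simp [hK, hitBy]
  have hperm : (Fintype.card (Equiv.Perm (Fin n)) : ℝ) = n.factorial := by
    rw [Fintype.card_perm, Fintype.card_fin]
  have step : ∀ m : Fin n,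
      ∑ σ : Equiv.Perm (Fin n),
        ((lostFaces S c y₀ y₁ (insertedFirst σ (m + 1)) (σ m)).card : ℝ) ≤
      8 * (∑ σ : Equiv.Perm (Fin n), if σ m ∈ K then (1 : ℝ) else 0) +
        8 * n.factorial * (1 / ((m : ℝ) + 1)) := by
    intro m
    have hm : (0 : ℝ) < (m : ℝ) + 1 := by positivity
    have h1 := sum_last_inserted (fun R s => ((lostFaces S c y₀ y₁ R s).card : ℝ)) m
    have h2 := sum_last_inserted (fun _ s => if s ∈ K then (1 : ℝ) else 0) m
    have h3 : ∑ σ : Equiv.Perm (Fin n), ∑ s ∈ insertedFirst σ (m + 1),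
        ((lostFaces S c y₀ y₁ (insertedFirst σ (m + 1)) s).card : ℝ) ≤
        ∑ σ : Equiv.Perm (Fin n), 8 * ((∑ s ∈ insertedFirst σ (m + 1),
          if s ∈ K then (1 : ℝ) else 0) + 1) := by
      refine Finset.sum_le_sum fun σ _ => ?_
      rw [← hhit]
      exact_mod_cast sum_lostFaces_le S c y₀ y₁ (insertedFirst σ (m + 1))
    rw [← h1, ← Finset.mul_sum, Finset.sum_add_distrib, ← h2, Finset.sum_const, Finset.card_univ,
      nsmul_eq_mul, mul_one, hperm] at h3
    refine le_of_mul_le_mul_left (h3.trans_eq ?_) hm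
    field_simp
  calc ∑ σ : Equiv.Perm (Fin n), ((queryNodes S c y₀ y₁ σ).card : ℝ)
      ≤ ∑ σ : Equiv.Perm (Fin n), (2 + ∑ m : Fin n,
          ((lostFaces S c y₀ y₁ (insertedFirst σ (m + 1)) (σ m)).card : ℝ)) :=
        Finset.sum_le_sum fun σ _ => by exact_mod_cast queryNodes_card_le σ
    _ = n.factorial * 2 + ∑ m : Fin n, ∑ σ : Equiv.Perm (Fin n),
          ((lostFaces S c y₀ y₁ (insertedFirst σ (m + 1)) (σ m)).card : ℝ) := by
        rw [Finset.sum_add_distrib, Finset.sum_comm, Finset.sum_const, Finset.card_univ,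
          nsmul_eq_mul, hperm]
    _ ≤ n.factorial * 2 + ∑ m : Fin n,
          (8 * (∑ σ : Equiv.Perm (Fin n), if σ m ∈ K then (1 : ℝ) else 0) +
            8 * n.factorial * (1 / ((m : ℝ) + 1))) :=
        add_le_add le_rfl (Finset.sum_le_sum fun m _ => step m)
    _ = _ := by
        rw [Finset.sum_add_distrib, ← Finset.mul_sum, ← Finset.mul_sum, Finset.sum_comm]
        have h4 : ∀ σ : Equiv.Perm (Fin n), ∑ m : Fin n, (if σ m ∈ K then (1 : ℝ) else 0) =
            K.card := by
          intro σ
          rw [Equiv.sum_comp σ fun s => if s ∈ K then (1 : ℝ) else 0]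
          simp
        simp only [h4]
        rw [Finset.sum_const, Finset.card_univ, nsmul_eq_mul, hperm]
        ring

theorem sum_one_div_le (n : ℕ) : ∑ m : Fin n, 1 / ((m : ℝ) + 1) ≤ 1 + Real.log n := by
  refine le_trans (le_of_eq ?_) (harmonic_le_one_add_log n)
  rw [Fin.sum_univ_eq_sum_range (fun m : ℕ => 1 / ((m : ℝ) + 1)), harmonic]
  push_cast
  simp

end Expectation

/-! ### The bound with an explicit constant -/

theorem theorem1 :
    ∃ C : ℝ, 0 < C ∧
      ∀ (n : ℕ), 2 ≤ n → ∀ (S : Fin n → PlaneSegment) (c y₀ y₁ : ℝ), y₀ ≤ y₁ →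
        (∀ σ : Equiv.Perm (Fin n), ∃ t : ℕ, TSDQueryHaltsIn S σ (verticalSegment c y₀ y₁) t) ∧
        ∀ T : Equiv.Perm (Fin n) → ℕ,
          (∀ σ, TSDQueryHaltsIn S σ (verticalSegment c y₀ y₁) (T σ)) →
          (∑ σ, (T σ : ℝ)) / (n.factorial : ℝ) ≤
            C * (({j : Fin n | ((S j).carrier ∩ verticalSegment c y₀ y₁).Nonempty}.ncard : ℝ) +
              Real.log n) := by
  classical
  refine ⟨100, by norm_num, fun n hn S c y₀ y₁ _ =>
    ⟨fun σ => exists_queryHaltsIn fun D => mem_queryNodes, fun T hT => ?_⟩⟩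
  have hk : {j : Fin n | ((S j).carrier ∩ verticalSegment c y₀ y₁).Nonempty}.ncard =
      (hitBy S Finset.univ (verticalSegment c y₀ y₁)).card := by
    rw [← Set.ncard_coe_finset]
    simp [hitBy]
  have hsum : ∑ σ, (T σ : ℝ) ≤
      ∑ σ : Equiv.Perm (Fin n), (1 + 4 * ((queryNodes S c y₀ y₁ σ).card : ℝ)) :=
    Finset.sum_le_sum fun σ _ => by exact_mod_cast (hT σ).le fun D => mem_queryNodes
  rw [Finset.sum_add_distrib, ← Finset.mul_sum, Finset.sum_const, Finset.card_univ,
    Fintype.card_perm, Fintype.card_fin, nsmul_eq_mul, mul_one] at hsum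
  have hnodes := sum_queryNodes_card_le (S := S) (c := c) (y₀ := y₀) (y₁ := y₁)
  have hharm := sum_one_div_le n
  have hfac : (0 : ℝ) < n.factorial := by exact_mod_cast n.factorial_pos
  -- This is where n ≥ 2 is needed: the additive constant 9 + 32 = 41 must be absorbed into the
  -- spare 68 log n.
  have hlog : (69 / 100 : ℝ) ≤ Real.log n := by
    have h2 : Real.log 2 ≤ Real.log n :=
      Real.log_le_log (by norm_num) (by exact_mod_cast hn)
    have := Real.log_two_gt_d9
    linarith
  have hkn : (0 : ℝ) ≤ (hitBy S Finset.univ (verticalSegment c y₀ y₁)).card := Nat.cast_nonneg _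
  rw [hk, div_le_iff₀ hfac]
  -- The numbers come from 1 + 4(2 + 8x) = 9 + 32x.
  calc ∑ σ, (T σ : ℝ) ≤ n.factorial * (9 + 32 *
        ((hitBy S Finset.univ (verticalSegment c y₀ y₁)).card + ∑ m : Fin n, 1 / ((m : ℝ) + 1))) := by
        linarith
    _ ≤ n.factorial * (100 * ((hitBy S Finset.univ (verticalSegment c y₀ y₁)).card +
        Real.log n)) := mul_le_mul_of_nonneg_left (by linarith) hfac.le
    _ = _ := mul_comm _ _
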